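/- **Setting.** A measurement scenario $(X,\mathcal M,\mathbf O)$ consists of a finite set $X$, a non-empty family $\mathcal M$ of subsets of $X$ (the maximal contexts) that covers $X$ and is an antichain for inclusion, and, for each $x\in X$, a second-countable locally compact Hausdorff space $O_x$ with its Borel $\sigma$-algebra. For $U\subseteq X$ let $O_U=\prod_{x\in U}O_x$, and for a measure $\mu$ on $O_V$ and $U\subseteq V$ let $\mu|_U$ be its marginal on $O_U$. An empirical model is a family $e=(e_C)_{C\in\mathcal M}$ of probability measures $e_C$ on $O_C$ with $e_C|_{C\cap C'}=e_{C'}|_{C\cap C'}$ for all $C,C'\in\mathcal M$. It is noncontextual if there is a probability measure $\mu$ on $O_X$ with $\mu|_C=e_C$ for all $C\in\mathcal M$. The noncontextual fraction of $e$ is $$\mathrm{NCF}(e)=\sup\{\mu(O_X) : \mu \text{ a measure on } O_X,\ \mu|_C\le e_C\text{ for all }C\in\mathcal M\},$$ and the contextual fraction of $e$ is $\mathrm{CF}(e)=1-\mathrm{NCF}(e)$. A generalised Bell inequality $(\beta,R)$ is a family $\beta=(\beta_C)_{C\in\mathcal M}$ of continuous functions $\beta_C\in C_0(O_C,\mathbb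 R)$ vanishing at infinity, together with $R\in\mathbb R$, such that $\langle\beta,e'\rangle:=\sum_{C\in\mathcal M}\int_{O_C}\beta_C\,de'_C\le R$ for every noncontextual empirical model $e'$ on the scenario. With $\|\beta\|:=\sum_{C\in\mathcal M}\sup\{\beta_C(o):o\in O_C\}$, its normalised violation by an empirical model $e$ is $$\frac{\max\{0,\langle\beta,e\rangle-R\}}{\|\beta\|-R},$$ which is read as $0$ if $\|\beta\|=R$ (the numerator is then $0$). **Theorem (Bell inequalities and contextual fraction).** Let $e$ be an empirical model on a measurement scenario as above. (i) The normalised violation by $e$ of any generalised Bell inequality is at most $\mathrm{CF}(e)$. (ii) If $\mathrm{CF}(e)>0$, then for every $\varepsilon>0$ there is a generalised Bell inequality $(\beta,R)$ with $R<\|\beta\|$ whose normalised violation by $e$ is at least $\mathrm{CF}(e)-\varepsilon$. -/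

import Mathlib

open MeasureTheory

universe u v

/-- The combinatorial part `(X, M)` of a measurement scenario `(X, M, O)`: a family `M` of
maximal contexts (sets of jointly performable measurements) that covers `X` and is an antichain
for inclusion. -/
structure MeasurementCover (X : Type u) where
  contexts : Finset (Finset X)
  covers : ∀ x : X, ∃ C ∈ contexts, x ∈ C
  antichain : IsAntichain (· ⊆ ·) (contexts : Set (Finset X))

/-- The joint outcome space `O_U = ∏_{x ∈ U} O_x` of a set `U` of measurements, with the product
topology and the product `σ`-algebra. -/
abbrev JointOutcome {X : Type u} (O : X → Type v) (U : Finset X) : Type (max u v) :=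
  (x : U) → O x

/-- An empirical model on the scenario `(X, M, O)`: a probability measure `e_C` on `O_C` for each
maximal context `C`, such that `e_C` and `e_{C'}` have the same marginal on `O_{C ∩ C'}`. -/
structure EmpiricalModel {X : Type u} [DecidableEq X] (S : MeasurementCover X) (O : X → Type v)
    [∀ x, MeasurableSpace (O x)] where
  measure : (C : S.contexts) → Measure (JointOutcome O C.1)
  isProbabilityMeasure : ∀ C, IsProbabilityMeasure (measure C)
  compatible : ∀ C C' : S.contexts,
    (measure C).map
        (Finset.restrict₂ (π := O) (Finset.inter_subset_left : C.1 ∩ C'.1 ⊆ C.1)) =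
      (measure C').map
        (Finset.restrict₂ (π := O) (Finset.inter_subset_right : C.1 ∩ C'.1 ⊆ C'.1))

namespace EmpiricalModel

variable {X : Type u} [DecidableEq X] {S : MeasurementCover X} {O : X → Type v}
  [∀ x, MeasurableSpace (O x)]

/-- `e` is noncontextual (extendable): some probability measure on the global outcome space
`O_X = ∏_{x ∈ X} O_x` has every `e_C` as its marginal on `O_C`. -/
def Noncontextual (e : EmpiricalModel S O) : Prop :=
  ∃ μ : Measure ((x : X) → O x), IsProbabilityMeasure μ ∧
    ∀ C : S.contexts, μ.map (Finset.restrict (π := O) C.1) = e.measure C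

/-- The noncontextual fraction `NCF(e) = sup {μ(O_X) | μ a measure on O_X, μ|_C ≤ e_C for all C}`.
The supremum is taken in `[0, ∞]`; it is at most `1` as soon as there is a context. -/
noncomputable def noncontextualFraction (e : EmpiricalModel S O) : ℝ :=
  (sSup {m : ENNReal | ∃ μ : Measure ((x : X) → O x),
    (∀ C : S.contexts, μ.map (Finset.restrict (π := O) C.1) ≤ e.measure C) ∧
      m = μ Set.univ}).toReal

/-- The contextual fraction `CF(e) = 1 - NCF(e)`. -/
noncomputable def contextualFraction (e : EmpiricalModel S O) : ℝ :=
  1 - e.noncontextualFraction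

end EmpiricalModel

section Bell

variable {X : Type u} [DecidableEq X] {S : MeasurementCover X} {O : X → Type v}
  [∀ x, TopologicalSpace (O x)] [∀ x, MeasurableSpace (O x)]

/-- The pairing `⟨β, e⟩ = ∑_C ∫_{O_C} β_C d e_C`, for `β_C ∈ C₀(O_C, ℝ)`. -/
noncomputable def bellPairing
    (β : (C : S.contexts) → ZeroAtInftyContinuousMap (JointOutcome O C.1) ℝ)
    (e : EmpiricalModel S O) : ℝ :=
  ∑ C : S.contexts, ∫ o, β C o ∂(e.measure C)

variable (S O) in
/-- A generalised Bell inequality `(β, R)`: functions `β_C ∈ C₀(O_C, ℝ)` and a bound `R` such that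
`⟨β, e⟩ ≤ R` for every noncontextual empirical model `e`. -/
structure BellInequality where
  β : (C : S.contexts) → ZeroAtInftyContinuousMap (JointOutcome O C.1) ℝ
  R : ℝ
  bound : ∀ e : EmpiricalModel S O, e.Noncontextual → bellPairing β e ≤ R

namespace BellInequality

/-- The algebraic bound `‖β‖ = ∑_C sup {β_C(o) | o ∈ O_C}`. -/
noncomputable def algebraicBound (B : BellInequality S O) : ℝ :=
  ∑ C : S.contexts, ⨆ o : JointOutcome O C.1, B.β C o

/-- The normalised violation `max {0, ⟨β, e⟩ - R} / (‖β‖ - R)` of `(β, R)` by `e`. If `‖β‖ ≤ R`,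
the numerator is zero and so is the quotient (with `0 / 0 = 0`). -/
noncomputable def normalisedViolation (B : BellInequality S O) (e : EmpiricalModel S O) : ℝ :=
  max 0 (bellPairing B.β e - B.R) / (B.algebraicBound - B.R)

end BellInequality

end Bell

/-!
Write `N` for the number of contexts, and `μ|_C` for the marginal of `μ` on `O_C`.

*Upper bound.* If `μ` has marginals `μ|_C ≤ e_C` and mass `m`, then `⟨β, e⟩` splits into
`∑ C, ∫ β_C d μ|_C`, which is at most `m R` because `μ / m` defines a noncontextual model
(`BellInequality.sum_integral_map_le`), and the integrals against `e_C - μ|_C`, which sum to at most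
`(1 - m) ‖β‖`. Hence `⟨β, e⟩ - R ≤ (1 - m) (‖β‖ - R)` (`bellPairing_sub_le`); take the supremum
over `μ`.

*Attainment up to `ε`.* The linear program defining `NCF(e)` has no duality gap, in the following
form. For `g` continuous with compact support on `O_X`, let `coverCost g` be the infimum of
`∑ C, ∫ f_C d e_C` over nonnegative bounded continuous `f_C` with `∑ C, f_C(o|_C) ≥ g(o)`. This is a
sublinear functional of `g`. By Hahn–Banach there is a linear functional below it that agrees with
it at a given `g₀`; such a functional is positive, so by the Riesz–Markov–Kakutani theorem it is
integration against a measure `μ`. Being below `coverCost` forces `μ|_C ≤ e_C`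
(`exists_measure_map_le_integral_eq_coverCost`), and so `coverCost g₀ = ∫ g₀ dμ ≤ NCF(e)` when
`g₀ ≤ 1`.

To obtain functions vanishing at infinity, choose `χ_C` with values in `[0, 1]`, with compact
support, and with `∫ χ_C d e_C` close to `1`; this uses the regularity of `e_C`. The function
`g₀ = (∑ C, χ_C - (N - 1))⁺` has compact support (`excess`). If `f` covers `g₀` at a cost close to
optimal, then `β_C = (χ_C - f_C)⁺` satisfies `∑ C, β_C(o|_C) ≤ N - 1` at every `o`: either some term
vanishes, or the sum equals `∑ C, χ_C - ∑ C, f_C`. So `(β, N - 1)` is a Bell inequality; moreover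
`‖β‖ ≤ N` and `⟨β, e⟩ - (N - 1)` is at least `1 - NCF(e)` up to `ε` (`exists_bellInequality_ge`).
-/

open scoped ENNReal BoundedContinuousFunction CompactlySupported

/-! ### Duality for measures with dominated marginals -/

section Duality

variable {ι : Type*} [Fintype ι] {Y : Type*} {Z : ι → Type*}
  [∀ i, TopologicalSpace (Z i)] [∀ i, MeasurableSpace (Z i)]

/-- The costs of covering `g`: the values `∑ i, ∫ f i ∂(ν i)` over all families of nonnegative
bounded continuous functions `f i` on `Z i` whose pullbacks along `ρ i` add up to at least `g`. -/
def coverCosts (ρ : ∀ i, Y → Z i) (ν : ∀ i, Measure (Z i)) (g : Y → ℝ) : Set ℝ :=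
  {r | ∃ f : ∀ i, Z i →ᵇ ℝ, (∀ i z, 0 ≤ f i z) ∧ (∀ y, g y ≤ ∑ i, f i (ρ i y)) ∧
    r = ∑ i, ∫ z, f i z ∂(ν i)}

/-- The infimum of the costs of covering `g`. -/
noncomputable def coverCost (ρ : ∀ i, Y → Z i) (ν : ∀ i, Measure (Z i)) (g : Y → ℝ) : ℝ :=
  sInf (coverCosts ρ ν g)

variable {ρ : ∀ i, Y → Z i} {ν : ∀ i, Measure (Z i)} {g : Y → ℝ}

theorem nonneg_of_mem_coverCosts {r : ℝ} (hr : r ∈ coverCosts ρ ν g) : 0 ≤ r := by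
  obtain ⟨f, hf, -, rfl⟩ := hr
  exact Finset.sum_nonneg fun i _ => integral_nonneg (hf i)

theorem bddBelow_coverCosts : BddBelow (coverCosts ρ ν g) :=
  ⟨0, fun _ hr => nonneg_of_mem_coverCosts hr⟩

theorem coverCost_nonneg : 0 ≤ coverCost ρ ν g :=
  Real.sInf_nonneg fun _ hr => nonneg_of_mem_coverCosts hr

theorem coverCost_le {r : ℝ} (hr : r ∈ coverCosts ρ ν g) : coverCost ρ ν g ≤ r :=
  csInf_le bddBelow_coverCosts hr

theorem coverCost_nonpos (hg : ∀ y, g y ≤ 0) : coverCost ρ ν g ≤ 0 :=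
  coverCost_le ⟨fun _ => 0, by simp, by simpa using hg, by simp⟩

theorem smul_mem_coverCosts {c r : ℝ} (hc : 0 ≤ c) (hr : r ∈ coverCosts ρ ν g) :
    c * r ∈ coverCosts ρ ν (c • g) := by
  obtain ⟨f, hf, hfg, rfl⟩ := hr
  refine ⟨fun i => c • f i, fun i z => mul_nonneg hc (hf i z), fun y => ?_, ?_⟩
  · simpa [← Finset.mul_sum] using mul_le_mul_of_nonneg_left (hfg y) hc
  · simp [Finset.mul_sum, integral_const_mul]

section

variable [TopologicalSpace Y]

theorem coverCosts_nonempty [Nonempty ι] (g : C_c(Y, ℝ)) : (coverCosts ρ ν g).Nonempty := by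
  obtain ⟨i₀⟩ := ‹Nonempty ι›
  refine ⟨_, fun _ => BoundedContinuousFunction.const _ ‖g.toBoundedContinuousFunction‖,
    fun i z => norm_nonneg g.toBoundedContinuousFunction, fun y => ?_, rfl⟩
  calc g y ≤ ‖g.toBoundedContinuousFunction‖ :=
        (le_abs_self _).trans (g.toBoundedContinuousFunction.norm_coe_le_norm y)
    _ ≤ _ := Finset.single_le_sum (f := fun _ : ι => ‖g.toBoundedContinuousFunction‖)
        (fun _ _ => norm_nonneg _) (Finset.mem_univ i₀)

theorem coverCost_smul_le [Nonempty ι] {c : ℝ} (hc : 0 < c) (g : C_c(Y, ℝ)) :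
    coverCost ρ ν (c • g) ≤ c * coverCost ρ ν g := by
  rw [← div_le_iff₀' hc]
  refine le_csInf (coverCosts_nonempty g) fun r hr => ?_
  rw [div_le_iff₀' hc]
  exact coverCost_le (by simpa using smul_mem_coverCosts hc.le hr)

theorem coverCost_smul [Nonempty ι] {c : ℝ} (hc : 0 < c) (g : C_c(Y, ℝ)) :
    coverCost ρ ν (c • g) = c * coverCost ρ ν g := by
  refine (coverCost_smul_le hc g).antisymm ?_
  have h := coverCost_smul_le (ρ := ρ) (ν := ν) (inv_pos.2 hc) (c • g)
  rw [CompactlySupportedContinuousMap.coe_smul, inv_smul_smul₀ hc.ne'] at h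
  rwa [← div_eq_inv_mul, le_div_iff₀' hc] at h

theorem coverCost_add_le [Nonempty ι] [∀ i, OpensMeasurableSpace (Z i)] [∀ i, IsFiniteMeasure (ν i)]
    (g g' : C_c(Y, ℝ)) :
    coverCost ρ ν (g + g' : C_c(Y, ℝ)) ≤ coverCost ρ ν g + coverCost ρ ν g' := by
  rw [← sub_le_iff_le_add]
  refine le_csInf (coverCosts_nonempty g) fun r hr => ?_
  rw [sub_le_comm]
  refine le_csInf (coverCosts_nonempty g') fun r' hr' => ?_
  rw [sub_le_iff_le_add']
  obtain ⟨f, hf, hfg, rfl⟩ := hr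
  obtain ⟨f', hf', hfg', rfl⟩ := hr'
  refine coverCost_le ⟨fun i => f i + f' i, fun i z => add_nonneg (hf i z) (hf' i z),
    fun y => ?_, ?_⟩
  · simpa [Finset.sum_add_distrib] using add_le_add (hfg y) (hfg' y)
  · rw [← Finset.sum_add_distrib]
    refine Finset.sum_congr rfl fun i _ => ?_
    exact (integral_add ((f i).integrable (ν i)) ((f' i).integrable (ν i))).symm

/-- Hahn–Banach applied to the sublinear functional `coverCost`; the extension is positive because
`coverCost` is nonpositive on nonpositive functions. -/
theorem exists_positiveLinearMap_le_coverCost [Nonempty ι] [∀ i, OpensMeasurableSpace (Z i)]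
    [∀ i, IsFiniteMeasure (ν i)] (g₀ : C_c(Y, ℝ)) :
    ∃ Λ : C_c(Y, ℝ) →ₚ[ℝ] ℝ, Λ g₀ = coverCost ρ ν g₀ ∧
      ∀ g : C_c(Y, ℝ), Λ g ≤ coverCost ρ ν g := by
  have hzero : coverCost ρ ν (0 : C_c(Y, ℝ)) = 0 :=
    (coverCost_nonpos (by simp)).antisymm coverCost_nonneg
  obtain ⟨L, hL₀, hL⟩ := exists_extension_of_le_sublinear
    (LinearPMap.mkSpanSingleton' (σ := RingHom.id ℝ) g₀ (coverCost ρ ν g₀) (by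
      intro c hc
      rcases smul_eq_zero.1 hc with rfl | h
      · simp
      · rw [h, hzero]; simp))
    (fun g : C_c(Y, ℝ) => coverCost ρ ν g)
    (fun c hc g => coverCost_smul hc g)
    (fun g g' => coverCost_add_le g g')
    (by
      rintro ⟨x, hx⟩
      obtain ⟨c, rfl⟩ := Submodule.mem_span_singleton.1 hx
      rw [LinearPMap.mkSpanSingleton'_apply]
      simp only [RingHom.id_apply, smul_eq_mul]
      rcases lt_or_ge 0 c with hc | hc
      · exact (coverCost_smul hc g₀).ge
      · exact (mul_nonpos_of_nonpos_of_nonneg hc coverCost_nonneg).trans coverCost_nonneg)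
  refine ⟨PositiveLinearMap.mk₀ L fun g hg => ?_, ?_, hL⟩
  · have h := (hL (-g)).trans (coverCost_nonpos fun y => neg_nonpos.2 (hg y))
    rwa [map_neg, neg_nonpos] at h
  · have h := hL₀ ⟨g₀, Submodule.mem_span_singleton_self g₀⟩
    exact h.trans (LinearPMap.mkSpanSingleton'_apply_self (σ := RingHom.id ℝ) _ _ _ _)

variable [MeasurableSpace Y] [T2Space Y] [LocallyCompactSpace Y] [BorelSpace Y]
  [∀ i, T2Space (Z i)] [∀ i, LocallyCompactSpace (Z i)] [∀ i, BorelSpace (Z i)]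

/-- A positive functional below `coverCost` is represented by a measure with marginals below `ν i`:
by regularity it suffices to compare open sets, and a compact `K ⊆ ρ i ⁻¹' U` is covered by a
Urysohn function for `ρ i '' K ⊆ U`. -/
theorem map_rieszMeasure_le [∀ i, IsFiniteMeasure (ν i)] [∀ i, (ν i).OuterRegular]
    (hρ : ∀ i, Continuous (ρ i)) {Λ : C_c(Y, ℝ) →ₚ[ℝ] ℝ}
    (hΛ : ∀ g : C_c(Y, ℝ), Λ g ≤ coverCost ρ ν g) (i : ι) :
    (RealRMK.rieszMeasure Λ).map (ρ i) ≤ ν i := by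
  classical
  have hopen : ∀ U : Set (Z i), IsOpen U →
      RealRMK.rieszMeasure Λ (ρ i ⁻¹' U) ≤ ν i U := by
    intro U hU
    rw [(hU.preimage (hρ i)).measure_eq_iSup_isCompact]
    refine iSup₂_le fun K hKU => iSup_le fun hK => ?_
    obtain ⟨φ, hφ₁, hφ₀, -, hφ⟩ := exists_continuous_one_zero_of_isCompact
      (hK.image (hρ i)) hU.isClosed_compl
      (Set.disjoint_compl_right_iff_subset.2 (Set.image_subset_iff.2 hKU))
    obtain ⟨χ, hχ₁, -, hχc, hχ⟩ := exists_continuous_one_zero_of_isCompact hK isClosed_empty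
      (Set.disjoint_empty K)
    let F : Z i →ᵇ ℝ := BoundedContinuousFunction.ofNormedAddCommGroup φ φ.continuous 1 fun z => by
      rw [Real.norm_eq_abs, abs_le]; exact ⟨by linarith [(hφ z).1], (hφ z).2⟩
    let G : C_c(Y, ℝ) := ⟨χ * φ.comp ⟨ρ i, hρ i⟩, hχc.mul_right⟩
    have hG : ∀ y, G y = χ y * φ (ρ i y) := fun _ => rfl
    refine (RealRMK.rieszMeasure_le_of_eq_one Λ (f := G)
      (fun y => mul_nonneg (hχ y).1 (hφ _).1) hK fun y hy => ?_).trans ?_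
    · rw [hG, hχ₁ hy, hφ₁ ⟨y, hy, rfl⟩]; simp
    have hcost : ∫ z, φ z ∂(ν i) ∈ coverCosts ρ ν G := by
      refine ⟨Pi.single i F, fun j z => ?_, fun y => ?_, ?_⟩
      · rcases eq_or_ne j i with rfl | h
        · simpa using (show 0 ≤ F z from (hφ z).1)
        · simp [h]
      · rw [Finset.sum_eq_single_of_mem i (Finset.mem_univ i) (by
          intro j _ hj; simp [hj])]
        simpa [hG] using (show χ y * φ (ρ i y) ≤ F (ρ i y) from
          mul_le_of_le_one_left (hφ _).1 (hχ y).2)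
      · rw [Finset.sum_eq_single_of_mem i (Finset.mem_univ i) (by
          intro j _ hj; simp [hj])]
        simp [F]
    refine ENNReal.ofReal_le_of_le_toReal (((hΛ G).trans (coverCost_le hcost)).trans ?_)
    calc ∫ z, φ z ∂(ν i) ≤ ∫ z, U.indicator 1 z ∂(ν i) := by
          refine integral_mono (F.integrable (ν i))
            ((integrable_const (1 : ℝ)).indicator hU.measurableSet) fun z => ?_
          by_cases hz : z ∈ U
          · simpa [hz] using (hφ z).2
          · simpa [hz] using (hφ₀ hz).le
      _ = (ν i U).toReal := by
          rw [integral_indicator_one hU.measurableSet]; rfl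
  refine Measure.le_iff.2 fun A hA => ?_
  rw [Measure.map_apply (hρ i).measurable hA]
  rw [A.measure_eq_iInf_isOpen]
  refine le_iInf₂ fun U hAU => le_iInf fun hU => ?_
  exact (measure_mono (Set.preimage_mono hAU)).trans (hopen U hU)

/-- Absence of a duality gap: for compactly supported `g₀`, some measure on `Y` whose `i`-th
marginal is at most `ν i` integrates `g₀` to its covering cost. -/
theorem exists_measure_map_le_integral_eq_coverCost [Nonempty ι]
    [∀ i, IsFiniteMeasure (ν i)] [∀ i, (ν i).OuterRegular] (hρ : ∀ i, Continuous (ρ i))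
    (g₀ : C_c(Y, ℝ)) :
    ∃ μ : Measure Y, (∀ i, μ.map (ρ i) ≤ ν i) ∧ ∫ y, g₀ y ∂μ = coverCost ρ ν g₀ := by
  obtain ⟨Λ, hΛ₀, hΛ⟩ := exists_positiveLinearMap_le_coverCost (ρ := ρ) (ν := ν) g₀
  exact ⟨RealRMK.rieszMeasure Λ, map_rieszMeasure_le hρ hΛ,
    (RealRMK.integral_rieszMeasure Λ g₀).trans hΛ₀⟩

end

end Duality

/-- On a locally compact Hausdorff space a regular probability measure almost integrates some
compactly supported `[0, 1]`-valued continuous function to `1`. -/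
theorem exists_hasCompactSupport_integral_gt {Z : Type*} [TopologicalSpace Z] [T2Space Z]
    [LocallyCompactSpace Z] [MeasurableSpace Z] [BorelSpace Z] (ν : Measure Z)
    [IsProbabilityMeasure ν] [ν.Regular] {δ : ℝ} (hδ : 0 < δ) :
    ∃ χ : C(Z, ℝ), HasCompactSupport χ ∧ (∀ z, χ z ∈ Set.Icc (0 : ℝ) 1) ∧
      1 - δ < ∫ z, χ z ∂ν := by
  obtain ⟨K, -, hK, hνK⟩ := isOpen_univ.exists_lt_isCompact (μ := ν)
    (r := ENNReal.ofReal (1 - δ)) (by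
      rw [measure_univ, ENNReal.ofReal_lt_one]; linarith)
  obtain ⟨χ, hχ₁, -, hχc, hχ⟩ := exists_continuous_one_zero_of_isCompact hK isClosed_empty
    (Set.disjoint_empty K)
  refine ⟨χ, hχc, hχ, ?_⟩
  calc 1 - δ < (ν K).toReal := by
        by_contra! h
        exact hνK.not_ge ((ENNReal.le_ofReal_iff_toReal_le (measure_ne_top _ _)
          (ENNReal.toReal_nonneg.trans h)).2 h)
    _ = ∫ z, K.indicator 1 z ∂ν := by
        rw [integral_indicator_one hK.measurableSet]; rfl
    _ ≤ ∫ z, χ z ∂ν := by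
        refine integral_mono ((integrable_const (1 : ℝ)).indicator hK.measurableSet)
          (χ.continuous.integrable_of_hasCompactSupport hχc) fun z => ?_
        by_cases hz : z ∈ K
        · simpa [hz] using (hχ₁ hz).ge
        · simpa [hz] using (hχ z).1

theorem sum_le_card_sub_one {ι : Type*} [Fintype ι] {a : ι → ℝ} (ha : ∀ i, a i ≤ 1) {i₀ : ι}
    (h₀ : a i₀ ≤ 0) : ∑ i, a i ≤ (Fintype.card ι : ℝ) - 1 := by
  have h := Finset.single_le_sum (f := fun i => 1 - a i) (fun i _ => sub_nonneg.2 (ha i))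
    (Finset.mem_univ i₀)
  simp only [Finset.sum_sub_distrib, Finset.sum_const, Finset.card_univ, nsmul_eq_mul,
    mul_one] at h
  linarith

/-! ### Noncontextual models and the noncontextual fraction -/

section Models

variable {X : Type u} [DecidableEq X] {S : MeasurementCover X} {O : X → Type v}
  [∀ x, MeasurableSpace (O x)]

/-- The empirical model formed by the marginals of a probability measure on `O_X`. -/
noncomputable def EmpiricalModel.ofGlobal (S : MeasurementCover X) (μ : Measure ((x : X) → O x))
    [IsProbabilityMeasure μ] : EmpiricalModel S O where
  measure C := μ.map (Finset.restrict (π := O) C.1)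
  isProbabilityMeasure C :=
    Measure.isProbabilityMeasure_map (Finset.measurable_restrict C.1).aemeasurable
  compatible C C' := by
    rw [Measure.map_map (Finset.measurable_restrict₂ _) (Finset.measurable_restrict _),
      Measure.map_map (Finset.measurable_restrict₂ _) (Finset.measurable_restrict _)]
    rfl

theorem EmpiricalModel.noncontextual_ofGlobal (μ : Measure ((x : X) → O x))
    [IsProbabilityMeasure μ] : (EmpiricalModel.ofGlobal S μ).Noncontextual :=
  ⟨μ, inferInstance, fun _ => rfl⟩

theorem measure_univ_le_one {e : EmpiricalModel S O} (hS : S.contexts.Nonempty)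
    {μ : Measure ((x : X) → O x)}
    (hμ : ∀ C : S.contexts, μ.map (Finset.restrict (π := O) C.1) ≤ e.measure C) :
    μ Set.univ ≤ 1 := by
  obtain ⟨C, hC⟩ := hS
  have := e.isProbabilityMeasure ⟨C, hC⟩
  have h := hμ ⟨C, hC⟩ Set.univ
  rwa [Measure.map_apply (Finset.measurable_restrict C) MeasurableSet.univ, Set.preimage_univ,
    measure_univ (μ := e.measure ⟨C, hC⟩)] at h

theorem EmpiricalModel.le_noncontextualFraction {e : EmpiricalModel S O}
    (hS : S.contexts.Nonempty) {μ : Measure ((x : X) → O x)}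
    (hμ : ∀ C : S.contexts, μ.map (Finset.restrict (π := O) C.1) ≤ e.measure C) :
    μ.real Set.univ ≤ e.noncontextualFraction := by
  refine ENNReal.toReal_mono (ne_top_of_le_ne_top ENNReal.one_ne_top (sSup_le ?_))
    (le_sSup ⟨μ, hμ, rfl⟩)
  rintro _ ⟨μ', hμ', rfl⟩
  exact measure_univ_le_one hS hμ'

theorem EmpiricalModel.noncontextualFraction_le {e : EmpiricalModel S O}
    (hS : S.contexts.Nonempty) {a : ℝ}
    (h : ∀ μ : Measure ((x : X) → O x),
      (∀ C : S.contexts, μ.map (Finset.restrict (π := O) C.1) ≤ e.measure C) →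
        μ.real Set.univ ≤ a) :
    e.noncontextualFraction ≤ a := by
  have ha : 0 ≤ a := by
    simpa using h 0 fun C => by rw [Measure.map_zero]; exact Measure.zero_le _
  refine ENNReal.toReal_le_of_le_ofReal ha (sSup_le ?_)
  rintro _ ⟨μ, hμ, rfl⟩
  exact (ENNReal.le_ofReal_iff_toReal_le
    (ne_top_of_le_ne_top ENNReal.one_ne_top (measure_univ_le_one hS hμ)) ha).2 (h μ hμ)

end Models

/-! ### Weak duality: a Bell inequality bounds the contextual fraction -/

section WeakDuality

variable {X : Type u} [DecidableEq X] {S : MeasurementCover X} {O : X → Type v}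
  [∀ x, TopologicalSpace (O x)] [∀ x, MeasurableSpace (O x)]

/-- The defining bound of a Bell inequality is homogeneous in the global measure. -/
theorem BellInequality.sum_integral_map_le (B : BellInequality S O)
    (μ : Measure ((x : X) → O x)) [IsFiniteMeasure μ] :
    ∑ C : S.contexts, ∫ o, B.β C o ∂(μ.map (Finset.restrict (π := O) C.1)) ≤
      μ.real Set.univ * B.R := by
  rcases eq_or_ne μ 0 with rfl | hμ
  · simp
  have : NeZero μ := ⟨hμ⟩
  have h := B.bound _ (EmpiricalModel.noncontextual_ofGlobal ((μ Set.univ)⁻¹ • μ))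
  have hpos : 0 < μ.real Set.univ := by
    rw [measureReal_def, ENNReal.toReal_pos_iff]
    exact ⟨Measure.measure_univ_pos.2 hμ, measure_lt_top _ _⟩
  simp only [bellPairing, EmpiricalModel.ofGlobal, Measure.map_smul, integral_smul_measure,
    ENNReal.toReal_inv, smul_eq_mul, ← Finset.mul_sum] at h
  rwa [← measureReal_def, ← div_eq_inv_mul, div_le_iff₀' hpos] at h

variable [∀ C : S.contexts, BorelSpace (JointOutcome O C.1)]

theorem ZeroAtInftyContinuousMap.bddAbove_range {Z : Type*} [TopologicalSpace Z]
    (f : ZeroAtInftyContinuousMap Z ℝ) : BddAbove (Set.range f) :=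
  f.isBounded_range.bddAbove

theorem ZeroAtInftyContinuousMap.integrable {Z : Type*} [TopologicalSpace Z] [MeasurableSpace Z]
    [OpensMeasurableSpace Z] (ν : Measure Z) [IsFiniteMeasure ν]
    (f : ZeroAtInftyContinuousMap Z ℝ) : Integrable f ν :=
  f.toBCF.integrable ν

/-- Split `e_C` into `μ|_C`, whose contribution is controlled by `R`, and the remainder of mass
`1 - μ(O_X)`, whose contribution is controlled by the supremum of `β_C`. -/
theorem bellPairing_sub_le (B : BellInequality S O) (hS : S.contexts.Nonempty)
    {e : EmpiricalModel S O} {μ : Measure ((x : X) → O x)}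
    (hμ : ∀ C : S.contexts, μ.map (Finset.restrict (π := O) C.1) ≤ e.measure C) :
    bellPairing B.β e - B.R ≤ (1 - μ.real Set.univ) * (B.algebraicBound - B.R) := by
  have : IsFiniteMeasure μ := ⟨(measure_univ_le_one hS hμ).trans_lt ENNReal.one_lt_top⟩
  have key : ∀ C : S.contexts, ∫ o, B.β C o ∂(e.measure C) ≤
      (1 - μ.real Set.univ) * (⨆ o, B.β C o) +
        ∫ o, B.β C o ∂(μ.map (Finset.restrict (π := O) C.1)) := by
    intro C
    have := e.isProbabilityMeasure C
    set s := ⨆ o, B.β C o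
    have hm := Finset.measurable_restrict (X := O) C.1
    have h := integral_mono_measure (hμ C) (f := fun o => s - B.β C o)
      (Filter.Eventually.of_forall fun o => sub_nonneg.2 (le_ciSup (B.β C).bddAbove_range o))
      ((integrable_const s).sub ((B.β C).integrable _))
    rw [integral_sub (integrable_const s) ((B.β C).integrable _),
      integral_sub (integrable_const s) ((B.β C).integrable _), integral_const, integral_const,
      map_measureReal_apply hm MeasurableSet.univ, Set.preimage_univ,
      probReal_univ (μ := e.measure C)] at h
    simp only [smul_eq_mul] at h
    linarith
  have h := Finset.sum_le_sum fun (C : S.contexts) (_ : C ∈ Finset.univ) => key C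
  rw [Finset.sum_add_distrib, ← Finset.mul_sum] at h
  change bellPairing B.β e ≤ _ * B.algebraicBound + _ at h
  linarith [B.sum_integral_map_le μ]

theorem bellPairing_le_algebraicBound (B : BellInequality S O) (e : EmpiricalModel S O) :
    bellPairing B.β e ≤ B.algebraicBound := by
  refine Finset.sum_le_sum fun C _ => ?_
  have := e.isProbabilityMeasure C
  calc ∫ o, B.β C o ∂(e.measure C) ≤ ∫ _, (⨆ o, B.β C o) ∂(e.measure C) :=
        integral_mono ((B.β C).integrable _) (integrable_const _)
          fun o => le_ciSup (B.β C).bddAbove_range o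
    _ = _ := by simp

theorem normalisedViolation_le_contextualFraction (B : BellInequality S O)
    (hS : S.contexts.Nonempty) (e : EmpiricalModel S O) :
    B.normalisedViolation e ≤ e.contextualFraction := by
  rw [EmpiricalModel.contextualFraction, le_sub_comm]
  refine EmpiricalModel.noncontextualFraction_le hS fun μ hμ => ?_
  rw [le_sub_comm, BellInequality.normalisedViolation]
  have hμ1 : μ.real Set.univ ≤ 1 :=
    ENNReal.toReal_le_of_le_ofReal zero_le_one (by simpa using measure_univ_le_one hS hμ)
  rcases le_or_gt B.algebraicBound B.R with h | h
  · have := bellPairing_le_algebraicBound B e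
    rw [max_eq_left (by linarith), zero_div]
    linarith
  · rw [div_le_iff₀ (sub_pos.2 h)]
    exact max_le (mul_nonneg (by linarith) (by linarith)) (bellPairing_sub_le B hS hμ)

end WeakDuality

/-! ### Strong duality: Bell inequalities with almost maximal violation -/

section StrongDuality

variable {X : Type u} {S : MeasurementCover X} {O : X → Type v}
  [∀ x, TopologicalSpace (O x)]

/-- Since the contexts cover `X`, the points of `O_X` all of whose restrictions lie in given compact
sets form a compact set. -/
theorem isCompact_iInter_preimage_restrict [∀ x, T2Space (O x)]
    {K : (C : S.contexts) → Set (JointOutcome O C.1)} (hK : ∀ C, IsCompact (K C)) :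
    IsCompact (⋂ C : S.contexts, Finset.restrict (π := O) C.1 ⁻¹' K C) := by
  choose D hD hxD using S.covers
  refine (isCompact_univ_pi fun x =>
    (hK ⟨D x, hD x⟩).image (continuous_apply (⟨x, hxD x⟩ : D x))).of_isClosed_subset
    (isClosed_iInter fun C => (hK C).isClosed.preimage (by fun_prop)) fun o ho x _ => ?_
  exact ⟨_, Set.mem_iInter.1 ho ⟨D x, hD x⟩, rfl⟩

/-- The function `(∑ C, χ_C - (N - 1))⁺` on `O_X`, where `N` is the number of contexts. As
`χ_C ≤ 1`, it vanishes wherever some `χ_C` does, hence has compact support. -/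
noncomputable def excess [Finite X] [DecidableEq X] [∀ x, T2Space (O x)]
    (χ : (C : S.contexts) → C(JointOutcome O C.1, ℝ))
    (hχc : ∀ C, HasCompactSupport (χ C)) (hχ : ∀ C o, χ C o ≤ 1) : C_c((x : X) → O x, ℝ) where
  toFun o := max 0 (∑ C : S.contexts, χ C (C.1.restrict o) - ((Fintype.card S.contexts : ℝ) - 1))
  continuous_toFun := by fun_prop
  hasCompactSupport' := by
    refine HasCompactSupport.intro (isCompact_iInter_preimage_restrict hχc) fun o ho => ?_
    simp only [Set.mem_iInter, not_forall] at ho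
    obtain ⟨C, hC⟩ := ho
    exact max_eq_left (sub_nonpos.2
      (sum_le_card_sub_one (fun C => hχ C _) (image_eq_zero_of_notMem_tsupport hC).le))

variable [Finite X] [DecidableEq X] [∀ x, SecondCountableTopology (O x)]
  [∀ x, LocallyCompactSpace (O x)]
  [∀ x, T2Space (O x)] [∀ x, MeasurableSpace (O x)] [∀ x, BorelSpace (O x)]

/-- The inequality is `β_C = (χ_C - f_C)⁺`, `R = N - 1`, where `χ_C` is a compactly supported function
with `∫ χ_C d e_C` close to `1` and `(f_C)` is a nearly optimal covering of `excess χ`. By duality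
`∑ C, ∫ f_C d e_C` exceeds `NCF(e)` by at most `ε / 2`. -/
theorem exists_bellInequality_ge (hS : S.contexts.Nonempty) (e : EmpiricalModel S O) {ε : ℝ}
    (hε : 0 < ε) :
    ∃ B : BellInequality S O, B.algebraicBound - B.R ≤ 1 ∧
      e.contextualFraction - ε ≤ bellPairing B.β e - B.R := by
  have : Nonempty S.contexts := hS.to_subtype
  have := e.isProbabilityMeasure
  set N : ℝ := (Fintype.card S.contexts : ℝ) with hN
  have hsum_le : ∀ a : S.contexts → ℝ, (∀ C, a C ≤ 1) → ∑ C, a C ≤ N := fun a ha => by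
    simpa [hN] using Finset.sum_le_card_nsmul Finset.univ a 1 fun C _ => ha C
  have hNpos : 0 < N := by rw [hN]; exact_mod_cast Fintype.card_pos
  choose χ hχc hχ hχe using fun C : S.contexts =>
    exists_hasCompactSupport_integral_gt (e.measure C) (δ := ε / (2 * N)) (by positivity)
  let g := excess χ hχc fun C o => (hχ C o).2
  have hg_apply : ∀ o, g o = max 0 (∑ C : S.contexts, χ C (C.1.restrict o) - (N - 1)) :=
    fun _ => rfl
  obtain ⟨μ, hμ, hμg⟩ := exists_measure_map_le_integral_eq_coverCost
    (ρ := fun C : S.contexts => Finset.restrict (π := O) C.1) (ν := e.measure)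
    (fun C => by fun_prop) g
  have : IsFiniteMeasure μ := ⟨(measure_univ_le_one hS hμ).trans_lt ENNReal.one_lt_top⟩
  have hcost : coverCost (fun C : S.contexts => Finset.restrict (π := O) C.1) e.measure g ≤
      e.noncontextualFraction := by
    refine le_trans ?_ (EmpiricalModel.le_noncontextualFraction hS hμ)
    rw [← hμg]
    calc ∫ o, g o ∂μ ≤ ∫ _, (1 : ℝ) ∂μ := by
          refine integral_mono (g.continuous.integrable_of_hasCompactSupport g.hasCompactSupport)
            (integrable_const _) fun o => ?_
          rw [hg_apply]
          refine max_le zero_le_one ?_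
          linarith [hsum_le (fun C => χ C (C.1.restrict o)) fun C => (hχ C _).2]
      _ = _ := by simp
  obtain ⟨_, ⟨f, hf, hgf, rfl⟩, hfcost⟩ := exists_lt_of_csInf_lt (coverCosts_nonempty g)
    (hcost.trans_lt (lt_add_of_pos_right _ (half_pos hε)))
  -- The truncated differences `(χ_C - f_C)⁺` lie between `0` and `χ_C`, hence in `C_c ⊆ C₀`.
  let h : (C : S.contexts) → C_c(JointOutcome O C.1, ℝ) := fun C =>
    { toFun := fun o => max 0 (χ C o - f C o)
      continuous_toFun := by fun_prop
      hasCompactSupport' := (hχc C).mono fun o ho hχo => ho (max_eq_left (by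
        rw [hχo, zero_sub]; exact neg_nonpos.2 (hf C o))) }
  have hh0 : ∀ C o, 0 ≤ h C o := fun C o => le_max_left _ _
  have hh1 : ∀ C o, h C o ≤ 1 := fun C o =>
    max_le zero_le_one ((sub_le_self _ (hf C o)).trans (hχ C o).2)
  have hint : ∀ (C : S.contexts) (ν : Measure (JointOutcome O C.1)) [IsFiniteMeasure ν],
      Integrable (h C) ν := fun C ν _ =>
    (h C).continuous.integrable_of_hasCompactSupport (h C).hasCompactSupport
  have hsum : ∀ o : (x : X) → O x, ∑ C : S.contexts, h C (C.1.restrict o) ≤ N - 1 := by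
    intro o
    by_cases hz : ∃ C : S.contexts, h C (C.1.restrict o) ≤ 0
    · obtain ⟨C, hC⟩ := hz
      exact sum_le_card_sub_one (fun C => hh1 C _) hC
    · push Not at hz
      have : ∀ C : S.contexts,
          h C (C.1.restrict o) = χ C (C.1.restrict o) - f C (C.1.restrict o) := fun C =>
        max_eq_right (not_lt.1 fun hlt => (hz C).ne' (max_eq_left hlt.le))
      simp only [this, Finset.sum_sub_distrib]
      have := (le_max_right _ _).trans ((hg_apply o).symm.trans_le (hgf o))
      linarith
  let B : BellInequality S O :=
    { β := fun C => ⟨h C, zero_at_infty (h C)⟩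
      R := N - 1
      bound := by
        rintro e' ⟨μ', hμ', he'⟩
        calc ∑ C : S.contexts, ∫ o, h C o ∂(e'.measure C)
            = ∑ C : S.contexts, ∫ o, h C (C.1.restrict o) ∂μ' := by
              refine Finset.sum_congr rfl fun C _ => ?_
              rw [← he' C]
              exact integral_map (Finset.measurable_restrict C.1).aemeasurable
                (h C).continuous.aestronglyMeasurable
          _ = ∫ o, ∑ C : S.contexts, h C (C.1.restrict o) ∂μ' := by
              refine (integral_finsetSum _ fun C _ => ?_).symm
              have : IsProbabilityMeasure (e'.measure C) := e'.isProbabilityMeasure C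
              have hi := hint C (e'.measure C)
              rw [← he' C] at hi
              exact hi.comp_measurable (Finset.measurable_restrict C.1)
          _ ≤ ∫ _, (N - 1) ∂μ' := by
              refine integral_mono_of_nonneg
                (Filter.Eventually.of_forall fun o => Finset.sum_nonneg fun C _ => hh0 C _)
                (integrable_const _) (Filter.Eventually.of_forall hsum)
          _ = N - 1 := by simp }
  refine ⟨B, ?_, ?_⟩
  · have : B.algebraicBound ≤ N :=
      hsum_le _ fun C => Real.iSup_le (fun o => hh1 C o) zero_le_one
    change _ - (N - 1) ≤ 1
    linarith
  · have hpair : ∑ C : S.contexts, (1 - ε / (2 * N) - ∫ o, f C o ∂(e.measure C)) ≤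
        bellPairing B.β e := by
      refine Finset.sum_le_sum fun C _ => ?_
      have hχi : Integrable (χ C) (e.measure C) :=
        (χ C).continuous.integrable_of_hasCompactSupport (hχc C)
      calc 1 - ε / (2 * N) - ∫ o, f C o ∂(e.measure C)
          ≤ ∫ o, χ C o ∂(e.measure C) - ∫ o, f C o ∂(e.measure C) := by linarith [hχe C]
        _ = ∫ o, (χ C o - f C o) ∂(e.measure C) :=
            (integral_sub hχi ((f C).integrable _)).symm
        _ ≤ ∫ o, h C o ∂(e.measure C) :=
            integral_mono (hχi.sub ((f C).integrable _)) (hint C _) fun o => le_max_right _ _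
    rw [Finset.sum_sub_distrib, Finset.sum_const, Finset.card_univ, nsmul_eq_mul, ← hN] at hpair
    have hNε : N * (1 - ε / (2 * N)) = N - ε / 2 := by field_simp
    change _ ≤ _ - (N - 1)
    rw [EmpiricalModel.contextualFraction]
    linarith

end StrongDuality

theorem mainTheorem2 {X : Type u} [Finite X] [DecidableEq X] (S : MeasurementCover X)
    (hS : S.contexts.Nonempty) (O : X → Type v)
    [∀ x, TopologicalSpace (O x)] [∀ x, SecondCountableTopology (O x)]
    [∀ x, LocallyCompactSpace (O x)] [∀ x, T2Space (O x)]
    [∀ x, MeasurableSpace (O x)] [∀ x, BorelSpace (O x)]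
    (e : EmpiricalModel S O) :
    (∀ B : BellInequality S O, B.normalisedViolation e ≤ e.contextualFraction) ∧
      (0 < e.contextualFraction → ∀ ε : ℝ, 0 < ε →
        ∃ B : BellInequality S O, B.R < B.algebraicBound ∧
          e.contextualFraction - ε ≤ B.normalisedViolation e) := by
  refine ⟨fun B => normalisedViolation_le_contextualFraction B hS e, fun hCF ε hε => ?_⟩
  -- An error below `CF(e)` makes `⟨β, e⟩ - R` positive, hence also `‖β‖ - R`.
  obtain ⟨B, hB1, hB⟩ := exists_bellInequality_ge hS e (lt_min hε (half_pos hCF))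
  have hle := bellPairing_le_algebraicBound B e
  have hpos : 0 < bellPairing B.β e - B.R := by
    linarith [min_le_right ε (e.contextualFraction / 2)]
  have hden : 0 < B.algebraicBound - B.R := by linarith
  refine ⟨B, sub_pos.1 hden, ?_⟩
  rw [BellInequality.normalisedViolation, max_eq_right hpos.le]
  calc e.contextualFraction - ε ≤ bellPairing B.β e - B.R := by
        linarith [min_le_left ε (e.contextualFraction / 2)]
    _ ≤ _ := le_div_self hpos.le hden hB1
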